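/- Let $l:[0,\infty]\to[0,\infty]$ and let $c(x,y)=l(|x-y|)$ for $x,y\in\mathbb{R}$. Assume that $l$ is strictly convex, strictly decreasing and $C^1$ on $(0,\infty)$; that $c$ is real-valued and $C^1$ on $\{(x,y)\in\mathbb{R}^2: x\neq y\}$; that $c:\mathbb{R}^2\to[0,+\infty]$ is lower semicontinuous; and that $c(x,x)=+\infty$ for every $x\in\mathbb{R}$. Let $\alpha<\beta$ be real numbers, $I=[\alpha,\beta]$, and let $\mu$ be a probability measure on $\mathbb{R}$ with support $I$ and with a density $\rho:\mathbb{R}\to[0,\infty)$ with respect to Lebesgue measure such that $\rho(x)>0$ for all $x\in I$. Call a Borel map $T:\mathbb{R}\to\mathbb{R}$ optimal if $T_\#\mu=\mu$ and the plan $(\mathrm{id},T)_\#\mu$ minimizes $\gamma\mapsto\int c\,d\gamma$ among all measures $\gamma$ on $\mathbb{R}^2$ whose two marginals both equal $\mu$. Then an optimal map exists, any two optimal maps agree $\mu$-almost everywhere, and there are a point $a\in(\alpha,\beta)$ and a version $T$ of the optimal map (that is, an optimal map $T$, with which every optimal map agrees outside a $\mu$-null set) with the following properties. The map $T$ is strictly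 increasing on $[\alpha,a)$ and strictly increasing on $(a,\beta]$, with $T(\alpha)=T(\beta)=a$, $\lim_{x\uparrow a}T(x)=\beta$ and $\lim_{x\downarrow a}T(x)=\alpha$, so that $T$ is discontinuous at $a$. It maps $(\alpha,a)$ onto $(a,\beta)$ and $(a,\beta)$ onto $(\alpha,a)$. Moreover: (a) for all $x_1<x_1'$ in $(\alpha,a)$ we have $x_1<x_1'<T(x_1)<T(x_1')$, and $T(x)\in(a,\beta)$ for all $x\in(\alpha,a)$; (b) for all $x_2<x_2'$ in $(a,\beta)$ we have $T(x_2)<T(x_2')<x_2<x_2'$, and $T(x)\in(\alpha,a)$ for all $x\in(a,\beta)$; (c) for every nonempty open interval $(l_1,l_2)\subseteq I$ that does not contain $a$, $T((l_1,l_2))=(r_1,r_2)\subseteq I$ for some $r_1<r_2$; if $(l_1,l_2)\subseteq I$ contains $a$, then $T((l_1,l_2)\setminus\{a\})=(\alpha,T(l_2))\cup(T(l_1),\beta)$. Finally, $\mu([\alpha,a])=\mu([a,\beta])=\tfrac12$. -/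

import Mathlib

open MeasureTheory Set Filter Topology
open scoped ENNReal NNReal

noncomputable section

namespace RepulsiveTransport

/-- The cost `c(x,y) = l(|x-y|)` on the line attached to a profile `l : [0,∞] → [0,∞]`. -/
def cost (l : ℝ≥0∞ → ℝ≥0∞) (x y : ℝ) : ℝ≥0∞ := l (ENNReal.ofReal |x - y|)

/-- The standing assumptions on the cost. By `finite_off_diag` the functions composed with
`toReal` below are the genuine real-valued restrictions of `l` to `(0,∞)` and of `c` to the
complement of the diagonal. -/
structure IsRepulsiveCost (l : ℝ≥0∞ → ℝ≥0∞) : Prop where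
  strictConvex : StrictConvexOn ℝ (Ioi 0) fun r : ℝ => (l (ENNReal.ofReal r)).toReal
  strictAnti : StrictAntiOn (fun r : ℝ => (l (ENNReal.ofReal r)).toReal) (Ioi 0)
  contDiff_profile : ContDiffOn ℝ 1 (fun r : ℝ => (l (ENNReal.ofReal r)).toReal) (Ioi 0)
  finite_off_diag : ∀ x y : ℝ, x ≠ y → cost l x y ≠ ∞
  contDiff_cost :
    ContDiffOn ℝ 1 (fun p : ℝ × ℝ => (cost l p.1 p.2).toReal) {p | p.1 ≠ p.2}
  lowerSemicontinuous : LowerSemicontinuous fun p : ℝ × ℝ => cost l p.1 p.2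
  diag : ∀ x : ℝ, cost l x x = ∞

/-- `Γ(μ,ν)`: the measures on `ℝ × ℝ` with marginals `μ` and `ν`. -/
def plans (μ ν : Measure ℝ) : Set (Measure (ℝ × ℝ)) :=
  {γ | γ.map Prod.fst = μ ∧ γ.map Prod.snd = ν}

/-- The transport cost `C[γ] = ∫ c dγ`. -/
def planCost (l : ℝ≥0∞ → ℝ≥0∞) (γ : Measure (ℝ × ℝ)) : ℝ≥0∞ :=
  ∫⁻ p, cost l p.1 p.2 ∂γ

/-- The plan `γ_T = (id, T)_# μ` induced by a map `T`. -/
def mapPlan (μ : Measure ℝ) (T : ℝ → ℝ) : Measure (ℝ × ℝ) := μ.map fun x => (x, T x)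

/-- `T` is an optimal map from `μ` to `ν`: a Borel map pushing `μ` forward to `ν` whose induced
plan minimizes the transport cost among all plans. -/
structure IsOptimalMap (l : ℝ≥0∞ → ℝ≥0∞) (μ ν : Measure ℝ) (T : ℝ → ℝ) : Prop where
  measurable : Measurable T
  push : μ.map T = ν
  optimal : ∀ γ ∈ plans μ ν, planCost l (mapPlan μ T) ≤ planCost l γ

end RepulsiveTransport

end

/-! The proof is Kantorovich duality with an explicit potential. Let `a` be the median and let `τ`
shift mass by one half: it carries `[α,a]` increasingly onto `[a,β]`. The candidate `swapMap`
applies `τ` left of `a` and `τ⁻¹` from `a` on; it preserves `μ` because both halves carry mass 1/2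
(`exists_median_shift`).

With `L` the profile, choose `u` with `u'(s) = -L'(τ s - s)`, the first-order condition for `x` to
be paired with `τ x`, and set `w(τ x) = L(τ x - x) - u(x)`. Strict convexity of `L` gives `u(x) +
w(y) ≤ L(y - x)` for `x < y`, with equality only at `y = τ x` (`leftPot_add_rightPot_lt`). Gluing
`u` and `w` at `a`, after opposite constant shifts, yields a single `φ` with `φ(x) + φ(y) ≤ c(x,y)`.
Pairs on the same side of `a` are strict because `L` decreases (`potential_add_lt`).

Away from `a`, equality holds exactly on the graph of `swapMap`. Integrating the inequality against
a plan gives optimality; equality almost everywhere gives uniqueness. The remaining claims are read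
off from `τ`. -/

noncomputable section

namespace RepulsiveTransport

/-- The real-valued profile of the cost on `(0,∞)`. -/
def profile (l : ℝ≥0∞ → ℝ≥0∞) (r : ℝ) : ℝ := (l (ENNReal.ofReal r)).toReal

/-- The derivative of the left potential for the increasing pairing `x ↦ τ x`. -/
def leftSlope (l : ℝ≥0∞ → ℝ≥0∞) (τ : ℝ ≃o ℝ) (s : ℝ) : ℝ := -deriv (profile l) (τ s - s)

/-- The potential on the left half for the increasing pairing `x ↦ τ x`. -/
def leftPot (l : ℝ≥0∞ → ℝ≥0∞) (τ : ℝ ≃o ℝ) (x : ℝ) : ℝ := ∫ s in (0 : ℝ)..x, leftSlope l τ s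

/-- The potential on the right half for the increasing pairing `x ↦ τ x`. -/
def rightPot (l : ℝ≥0∞ → ℝ≥0∞) (τ : ℝ ≃o ℝ) (y : ℝ) : ℝ :=
  profile l (y - τ.symm y) - leftPot l τ (τ.symm y)

/-- The Kantorovich potential obtained by gluing the two half potentials continuously at `a`. -/
def potential (l : ℝ≥0∞ → ℝ≥0∞) (τ : ℝ ≃o ℝ) (a x : ℝ) : ℝ :=
  if x < a then leftPot l τ x + (rightPot l τ a - leftPot l τ a) / 2
  else rightPot l τ x - (rightPot l τ a - leftPot l τ a) / 2

/-- The map that applies `τ` to the left of `a` and its inverse to the right of `a`. -/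
def swapMap (τ : ℝ ≃o ℝ) (a x : ℝ) : ℝ := if x < a then τ x else τ.symm x

/-! ### Regularity and monotonicity of the profile. -/

section profile

variable {l : ℝ≥0∞ → ℝ≥0∞} (hl : IsRepulsiveCost l)
include hl

lemma IsRepulsiveCost.strictAntiOn_profile : StrictAntiOn (profile l) (Ioi 0) := hl.strictAnti

lemma IsRepulsiveCost.hasDerivAt_profile {r : ℝ} (hr : 0 < r) :
    HasDerivAt (profile l) (deriv (profile l) r) r :=
  ((hl.contDiff_profile.contDiffAt (Ioi_mem_nhds hr)).differentiableAt one_ne_zero).hasDerivAt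

lemma IsRepulsiveCost.continuousOn_profile : ContinuousOn (profile l) (Ioi 0) :=
  hl.contDiff_profile.continuousOn

lemma IsRepulsiveCost.continuousOn_deriv_profile :
    ContinuousOn (deriv (profile l)) (Ioi 0) :=
  ContDiffOn.continuousOn_deriv_of_isOpen (n := 1) hl.contDiff_profile isOpen_Ioi le_rfl

lemma IsRepulsiveCost.strictMonoOn_deriv_profile :
    StrictMonoOn (deriv (profile l)) (Ioi 0) :=
  StrictConvexOn.strictMonoOn_deriv hl.strictConvex
    fun _ hr => (hl.hasDerivAt_profile hr).differentiableAt

lemma IsRepulsiveCost.deriv_profile_nonpos {r : ℝ} (hr : 0 < r) : deriv (profile l) r ≤ 0 := by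
  rw [← derivWithin_of_isOpen isOpen_Ioi hr]
  exact hl.strictAntiOn_profile.antitoneOn.derivWithin_nonpos

lemma IsRepulsiveCost.cost_of_lt {x y : ℝ} (h : x < y) :
    cost l x y = ENNReal.ofReal (profile l (y - x)) := by
  have := hl.finite_off_diag x y h.ne
  rw [cost, abs_sub_comm, abs_of_pos (sub_pos.2 h)] at this ⊢
  rw [profile, ENNReal.ofReal_toReal this]

lemma IsRepulsiveCost.measurable_cost : Measurable fun p : ℝ × ℝ => cost l p.1 p.2 :=
  hl.lowerSemicontinuous.measurable

end profile

lemma cost_comm (l : ℝ≥0∞ → ℝ≥0∞) (x y : ℝ) : cost l x y = cost l y x := by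
  rw [cost, cost, abs_sub_comm]

/-! ### The half potentials and the glued potential. -/

section potential

variable {l : ℝ≥0∞ → ℝ≥0∞} (hl : IsRepulsiveCost l) {τ : ℝ ≃o ℝ} (hτ : ∀ x, x < τ x)

include hτ in
lemma symm_lt_self (y : ℝ) : τ.symm y < y := by
  simpa using hτ (τ.symm y)

include hl hτ

lemma continuous_leftSlope : Continuous (leftSlope l τ) := by
  refine Continuous.neg (hl.continuousOn_deriv_profile.comp_continuous ?_ fun s => ?_)
  · exact τ.continuous.sub continuous_id
  · exact sub_pos.2 (hτ s)

lemma hasDerivAt_leftPot (x : ℝ) : HasDerivAt (leftPot l τ) (leftSlope l τ x) x :=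
  ((continuous_leftSlope hl hτ).integral_hasStrictDerivAt 0 x).hasDerivAt

lemma continuous_leftPot : Continuous (leftPot l τ) :=
  continuous_iff_continuousAt.2 fun x => (hasDerivAt_leftPot hl hτ x).continuousAt

lemma monotone_leftPot : Monotone (leftPot l τ) := by
  refine monotone_of_deriv_nonneg (fun x => (hasDerivAt_leftPot hl hτ x).differentiableAt)
    fun x => ?_
  rw [(hasDerivAt_leftPot hl hτ x).deriv]
  exact neg_nonneg.2 (hl.deriv_profile_nonpos (sub_pos.2 (hτ x)))

lemma continuous_rightPot : Continuous (rightPot l τ) := by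
  refine Continuous.sub (hl.continuousOn_profile.comp_continuous ?_ fun y => ?_)
    ((continuous_leftPot hl hτ).comp τ.symm.continuous)
  · exact continuous_id.sub τ.symm.continuous
  · exact sub_pos.2 (symm_lt_self hτ y)

omit hl hτ in
lemma leftPot_add_rightPot_apply (x : ℝ) :
    leftPot l τ x + rightPot l τ (τ x) = profile l (τ x - x) := by
  simp [rightPot]

lemma hasDerivAt_profile_sub_leftPot {x y : ℝ} (h : x < y) :
    HasDerivAt (fun x => profile l (y - x) - leftPot l τ x)
      (deriv (profile l) (τ x - x) - deriv (profile l) (y - x)) x := by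
  have h1 := (hl.hasDerivAt_profile (sub_pos.2 h)).comp x ((hasDerivAt_id x).const_sub y)
  refine (h1.sub (hasDerivAt_leftPot hl hτ x)).congr_deriv ?_
  simp only [leftSlope]
  ring

/-- For fixed `y = τ z`, the function `x ↦ L(y - x) - u(x)` on `x < y` has its strict minimum at
`z`, with value `w(y)`: since `L'` and `τ` are strictly increasing, its derivative is negative
before `z` and positive after. -/
lemma leftPot_add_rightPot_lt {x y : ℝ} (h : x < y) (hne : y ≠ τ x) :
    leftPot l τ x + rightPot l τ y < profile l (y - x) := by
  obtain ⟨z, rfl⟩ := τ.surjective y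
  have hzx : x ≠ z := fun e => hne (by rw [e])
  have key : profile l (τ z - z) - leftPot l τ z < profile l (τ z - x) - leftPot l τ x := by
    have hd {w : ℝ} (hw : w < τ z) := hasDerivAt_profile_sub_leftPot hl hτ hw
    rcases lt_or_gt_of_ne hzx with hlt | hgt
    · refine strictAntiOn_of_deriv_neg (convex_Icc x z)
        (fun w hw => (hd (hw.2.trans_lt (hτ z))).continuousAt.continuousWithinAt) (fun w hw => ?_)
        (left_mem_Icc.2 hlt.le) (right_mem_Icc.2 hlt.le) hlt
      rw [interior_Icc] at hw
      rw [(hd (hw.2.trans (hτ z))).deriv, sub_neg]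
      exact hl.strictMonoOn_deriv_profile (sub_pos.2 (hτ w)) (sub_pos.2 (hw.2.trans (hτ z)))
        (sub_lt_sub_right (τ.strictMono hw.2) w)
    · refine strictMonoOn_of_deriv_pos (convex_Icc z x)
        (fun w hw => (hd (hw.2.trans_lt h)).continuousAt.continuousWithinAt) (fun w hw => ?_)
        (left_mem_Icc.2 hgt.le) (right_mem_Icc.2 hgt.le) hgt
      rw [interior_Icc] at hw
      rw [(hd (hw.2.trans h)).deriv, sub_pos]
      exact hl.strictMonoOn_deriv_profile (sub_pos.2 (hw.2.trans h)) (sub_pos.2 (hτ w))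
        (sub_lt_sub_right (τ.strictMono hw.1) w)
  have := leftPot_add_rightPot_apply (l := l) (τ := τ) z
  linarith

lemma leftPot_add_rightPot_le {x y : ℝ} (h : x < y) :
    leftPot l τ x + rightPot l τ y ≤ profile l (y - x) := by
  by_cases hne : y = τ x
  · rw [hne, leftPot_add_rightPot_apply]
  · exact (leftPot_add_rightPot_lt hl hτ h hne).le

/-- Test the inequality for the larger point `z` against the partner `τ⁻¹ y` of the smaller one;
moving from `z` back to `y` only raises the cost. -/
lemma antitone_rightPot : Antitone (rightPot l τ) := by
  intro y z hyz
  have hy := symm_lt_self hτ y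
  have h1 := leftPot_add_rightPot_le hl hτ (hy.trans_le hyz)
  have h2 := hl.strictAntiOn_profile.antitoneOn (sub_pos.2 hy) (sub_pos.2 (hy.trans_le hyz))
    (sub_le_sub_right hyz (τ.symm y))
  rw [rightPot.eq_1 l τ y]
  linarith

/-- Across `a` the gluing constants cancel. For `x < y < a`, monotonicity of `u` reduces the sum to
`u(x) + w(a) ≤ L(a - x) < L(y - x)`; for `a < x < y`, compare with `u(a) + w(y)`. The point `x = a`
is excluded because the pair `(a, τ a)` attains equality. -/
lemma potential_add_lt {a x y : ℝ} (hx : x ≠ a) (h : x < y)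
    (hne : ¬(x < a ∧ y = τ x)) :
    potential l τ a x + potential l τ a y < profile l (y - x) := by
  rcases lt_or_gt_of_ne hx with hxa | hxa
  · rcases lt_or_ge y a with hya | hya
    · have h1 := monotone_leftPot hl hτ hya.le
      have h2 := leftPot_add_rightPot_le hl hτ hxa
      have h3 := hl.strictAntiOn_profile (sub_pos.2 h) (sub_pos.2 hxa) (sub_lt_sub_right hya x)
      simp only [potential, hxa, hya, if_true]
      linarith
    · have := leftPot_add_rightPot_lt hl hτ h fun e => hne ⟨hxa, e⟩
      simp only [potential, hxa, hya.not_gt, if_true, if_false]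
      linarith
  · have hya : a < y := hxa.trans h
    have h1 := antitone_rightPot hl hτ hxa.le
    have h2 := leftPot_add_rightPot_le hl hτ hya
    have h3 := hl.strictAntiOn_profile (sub_pos.2 h) (sub_pos.2 hya) (sub_lt_sub_left hxa y)
    simp only [potential, hxa.not_gt, hya.not_gt, if_false]
    linarith

omit hl hτ in
lemma potential_add_apply {a x : ℝ} (hx : x < a) (hxa : a ≤ τ x) :
    potential l τ a x + potential l τ a (τ x) = profile l (τ x - x) := by
  rw [← leftPot_add_rightPot_apply]
  simp only [potential, hx, hxa.not_gt, if_true, if_false]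
  ring

lemma measurable_potential (a : ℝ) : Measurable (potential l τ a) :=
  Measurable.ite measurableSet_Iio ((continuous_leftPot hl hτ).measurable.add_const _)
    ((continuous_rightPot hl hτ).measurable.sub_const _)

lemma exists_abs_potential_le (a α β : ℝ) :
    ∃ M, ∀ x ∈ Icc α β, |potential l τ a x| ≤ M := by
  set C := (rightPot l τ a - leftPot l τ a) / 2
  obtain ⟨M₁, h₁⟩ := isCompact_Icc.exists_bound_of_continuousOn (s := Icc α β)
    ((continuous_leftPot hl hτ).add_const C).continuousOn
  obtain ⟨M₂, h₂⟩ := isCompact_Icc.exists_bound_of_continuousOn (s := Icc α β)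
    ((continuous_rightPot hl hτ).sub (continuous_const (y := C))).continuousOn
  refine ⟨max M₁ M₂, fun x hx => ?_⟩
  unfold potential
  split_ifs
  · exact (h₁ x hx).trans (le_max_left _ _)
  · exact (h₂ x hx).trans (le_max_right _ _)

end potential

lemma measurable_swapMap (τ : ℝ ≃o ℝ) (a : ℝ) : Measurable (swapMap τ a) :=
  Measurable.ite measurableSet_Iio τ.continuous.measurable τ.symm.continuous.measurable

/-! ### Duality, optimality and uniqueness. -/

section duality

variable {l : ℝ≥0∞ → ℝ≥0∞} (hl : IsRepulsiveCost l) {τ : ℝ ≃o ℝ} (hτ : ∀ x, x < τ x)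
  {α β a M : ℝ} (hα : τ α = a) (hβ : τ a = β) (hM : ∀ x ∈ Icc α β, |potential l τ a x| ≤ M)

-- Adding `M` makes the potential nonnegative on `[α,β]`, so that the duality argument can run in
-- `ℝ≥0∞`, where the cost may be infinite.
include hl hM in
lemma ofReal_potential_add_of_lt {x y : ℝ} (hx : x ∈ Icc α β) (hy : y ∈ Icc α β) (h : x < y) :
    ENNReal.ofReal (potential l τ a x + M) + ENNReal.ofReal (potential l τ a y + M) =
        ENNReal.ofReal (potential l τ a x + potential l τ a y + 2 * M) ∧
      cost l x y + ENNReal.ofReal (2 * M) = ENNReal.ofReal (profile l (y - x) + 2 * M) := by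
  have h1 := abs_le.1 (hM x hx)
  have h2 := abs_le.1 (hM y hy)
  have h3 : 0 ≤ profile l (y - x) := ENNReal.toReal_nonneg
  constructor
  · rw [← ENNReal.ofReal_add (by linarith) (by linarith)]
    ring_nf
  · rw [hl.cost_of_lt h, ENNReal.ofReal_add h3 (by linarith)]

include hl hτ hα hM in
lemma ofReal_potential_add_lt {x y : ℝ} (hx : x ∈ Ioo α β) (hy : y ∈ Ioo α β) (hxa : x ≠ a)
    (hya : y ≠ a) (hne : y ≠ swapMap τ a x) :
    ENNReal.ofReal (potential l τ a x + M) + ENNReal.ofReal (potential l τ a y + M) <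
      cost l x y + ENNReal.ofReal (2 * M) := by
  have main {x y : ℝ} (hx : x ∈ Ioo α β) (hy : y ∈ Ioo α β) (hxa : x ≠ a) (hlt : x < y)
      (hn : ¬(x < a ∧ y = τ x)) :
      ENNReal.ofReal (potential l τ a x + M) + ENNReal.ofReal (potential l τ a y + M) <
        cost l x y + ENNReal.ofReal (2 * M) := by
    obtain ⟨h1, h2⟩ := ofReal_potential_add_of_lt hl hM (Ioo_subset_Icc_self hx)
      (Ioo_subset_Icc_self hy) hlt
    have h4 := potential_add_lt hl hτ hxa hlt hn
    have h5 : 0 < profile l (y - x) + 2 * M := by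
      have := abs_le.1 (hM x (Ioo_subset_Icc_self hx))
      have := abs_le.1 (hM y (Ioo_subset_Icc_self hy))
      linarith
    rw [h1, h2, ENNReal.ofReal_lt_ofReal_iff h5]
    linarith
  rcases lt_trichotomy x y with hlt | rfl | hgt
  · refine main hx hy hxa hlt fun h => hne ?_
    rw [swapMap, if_pos h.1, h.2]
  · rw [hl.diag, top_add]
    exact ENNReal.add_lt_top.2 ⟨ENNReal.ofReal_lt_top, ENNReal.ofReal_lt_top⟩
  · rw [cost_comm, add_comm (ENNReal.ofReal _)]
    refine main hy hx hya hgt fun h => hne ?_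
    -- Here `x = τ y` with `y > α`, so `x` lies beyond `τ α = a` and the swap sends it back to `y`.
    have : a < x := by rw [h.2, ← hα]; exact τ.strictMono hy.1
    rw [swapMap, if_neg this.not_gt, h.2, τ.symm_apply_apply]

include hα hβ in
lemma swapMap_mem_Ioo_left {x : ℝ} (hx : x ∈ Ioo α a) : swapMap τ a x ∈ Ioo a β := by
  rw [swapMap, if_pos hx.2]
  exact ⟨hα ▸ τ.strictMono hx.1, hβ ▸ τ.strictMono hx.2⟩

include hα hβ in
lemma swapMap_mem_Ioo_right {x : ℝ} (hx : x ∈ Ioo a β) : swapMap τ a x ∈ Ioo α a := by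
  rw [swapMap, if_neg hx.1.not_gt, mem_Ioo, τ.symm_apply_lt, τ.lt_symm_apply, hα, hβ]
  exact hx

include hl hτ hα hβ hM in
lemma ofReal_potential_add_swapMap {x : ℝ} (hx : x ∈ Ioo α β) (hxa : x ≠ a) :
    ENNReal.ofReal (potential l τ a x + M) +
        ENNReal.ofReal (potential l τ a (swapMap τ a x) + M) =
      cost l x (swapMap τ a x) + ENNReal.ofReal (2 * M) := by
  have hαa : α < a := hα ▸ hτ α
  have haβ : a < β := hβ ▸ hτ a
  have main {z : ℝ} (hz : z ∈ Ioo α a) :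
      ENNReal.ofReal (potential l τ a z + M) + ENNReal.ofReal (potential l τ a (τ z) + M) =
        cost l z (τ z) + ENNReal.ofReal (2 * M) := by
    have hT := swapMap_mem_Ioo_left hα hβ hz
    rw [swapMap, if_pos hz.2] at hT
    obtain ⟨h1, h2⟩ := ofReal_potential_add_of_lt hl hM ⟨hz.1.le, (hz.2.trans haβ).le⟩
      ⟨(hαa.trans hT.1).le, hT.2.le⟩ (hτ z)
    rw [h1, h2, potential_add_apply hz.2 hT.1.le]
  rcases lt_or_gt_of_ne hxa with h | h
  · rw [swapMap, if_pos h]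
    exact main ⟨hx.1, h⟩
  · have hT := swapMap_mem_Ioo_right hα hβ ⟨h, hx.2⟩
    have := main hT
    rw [swapMap, if_neg h.not_gt] at this ⊢
    rw [τ.apply_symm_apply] at this
    rw [cost_comm, add_comm (ENNReal.ofReal _), this]

variable {μ : Measure ℝ} [IsProbabilityMeasure μ] (hμ : ∀ᵐ x ∂μ, x ∈ Ioo α β ∧ x ≠ a)

include hl hτ hα hβ hM hμ

/-- Weak duality: the potential integrates through the marginals alone, so the bound is the same for
every plan. -/
lemma lintegral_potential_le {γ : Measure (ℝ × ℝ)} (hγ : γ ∈ plans μ μ) :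
    ∫⁻ x, ENNReal.ofReal (potential l τ a x + M) ∂μ +
        ∫⁻ x, ENNReal.ofReal (potential l τ a x + M) ∂μ ≤
      planCost l γ + ENNReal.ofReal (2 * M) := by
  have hv : Measurable fun x => ENNReal.ofReal (potential l τ a x + M) :=
    ((measurable_potential hl hτ a).add_const M).ennreal_ofReal
  have hγ1 : IsProbabilityMeasure γ := by
    refine ⟨?_⟩
    have : γ.map Prod.fst univ = 1 := by rw [hγ.1]; exact measure_univ
    rwa [Measure.map_apply measurable_fst MeasurableSet.univ, preimage_univ] at this
  have e1 : ∫⁻ x, ENNReal.ofReal (potential l τ a x + M) ∂μ =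
      ∫⁻ p, ENNReal.ofReal (potential l τ a p.1 + M) ∂γ := by
    conv_lhs => rw [← hγ.1]
    exact lintegral_map hv measurable_fst
  have e2 : ∫⁻ x, ENNReal.ofReal (potential l τ a x + M) ∂μ =
      ∫⁻ p, ENNReal.ofReal (potential l τ a p.2 + M) ∂γ := by
    conv_lhs => rw [← hγ.2]
    exact lintegral_map hv measurable_snd
  have e3 : planCost l γ + ENNReal.ofReal (2 * M) =
      ∫⁻ p, cost l p.1 p.2 + ENNReal.ofReal (2 * M) ∂γ := by
    rw [lintegral_add_right _ measurable_const, lintegral_const, measure_univ, mul_one, planCost]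
  nth_rewrite 2 [e2]
  rw [e1, e3, ← lintegral_add_left (f := fun p : ℝ × ℝ => ENNReal.ofReal (potential l τ a p.1 + M))
    (hv.comp measurable_fst)]
  refine lintegral_mono_ae ?_
  have h1 : ∀ᵐ p ∂γ, p.1 ∈ Ioo α β ∧ p.1 ≠ a :=
    ae_of_ae_map measurable_fst.aemeasurable (by rwa [hγ.1])
  have h2 : ∀ᵐ p ∂γ, p.2 ∈ Ioo α β ∧ p.2 ≠ a :=
    ae_of_ae_map measurable_snd.aemeasurable (by rwa [hγ.2])
  filter_upwards [h1, h2] with p hp1 hp2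
  by_cases h : p.2 = swapMap τ a p.1
  · rw [h]
    exact (ofReal_potential_add_swapMap hl hτ hα hβ hM hp1.1 hp1.2).le
  · exact (ofReal_potential_add_lt hl hτ hα hM hp1.1 hp2.1 hp1.2 hp2.2 h).le

omit hl hτ hα hβ hM hμ [IsProbabilityMeasure μ] in
lemma mapPlan_mem_plans {S : ℝ → ℝ} (hS : Measurable S) (hpush : μ.map S = μ) :
    mapPlan μ S ∈ plans μ μ := by
  have hm : Measurable fun x => (x, S x) := measurable_id.prodMk hS
  constructor
  · rw [mapPlan, Measure.map_map measurable_fst hm]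
    exact Measure.map_id
  · rw [mapPlan, Measure.map_map measurable_snd hm]
    exact hpush

omit hτ hα hβ hM hμ in
lemma planCost_mapPlan_add {S : ℝ → ℝ} (hS : Measurable S) (M : ℝ) :
    planCost l (mapPlan μ S) + ENNReal.ofReal (2 * M) =
      ∫⁻ x, cost l x (S x) + ENNReal.ofReal (2 * M) ∂μ := by
  rw [lintegral_add_right _ measurable_const, lintegral_const, measure_univ, mul_one, planCost,
    mapPlan, lintegral_map hl.measurable_cost (measurable_id'.prodMk hS)]

omit hα hβ hM hμ [IsProbabilityMeasure μ] in
lemma lintegral_potential_add_map {S : ℝ → ℝ} (hS : Measurable S) (hpush : μ.map S = μ) :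
    ∫⁻ x, ENNReal.ofReal (potential l τ a x + M) ∂μ +
        ∫⁻ x, ENNReal.ofReal (potential l τ a x + M) ∂μ =
      ∫⁻ x, ENNReal.ofReal (potential l τ a x + M) +
        ENNReal.ofReal (potential l τ a (S x) + M) ∂μ := by
  have hv : Measurable fun x => ENNReal.ofReal (potential l τ a x + M) :=
    ((measurable_potential hl hτ a).add_const M).ennreal_ofReal
  have e : ∫⁻ x, ENNReal.ofReal (potential l τ a x + M) ∂μ =
      ∫⁻ x, ENNReal.ofReal (potential l τ a (S x) + M) ∂μ := by
    conv_lhs => rw [← hpush]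
    exact lintegral_map hv hS
  nth_rewrite 2 [e]
  rw [← lintegral_add_left hv]

lemma planCost_swapMap_add (hpush : μ.map (swapMap τ a) = μ) :
    planCost l (mapPlan μ (swapMap τ a)) + ENNReal.ofReal (2 * M) =
      ∫⁻ x, ENNReal.ofReal (potential l τ a x + M) ∂μ +
        ∫⁻ x, ENNReal.ofReal (potential l τ a x + M) ∂μ := by
  rw [planCost_mapPlan_add hl (measurable_swapMap τ a),
    lintegral_potential_add_map hl hτ (measurable_swapMap τ a) hpush]
  refine lintegral_congr_ae ?_
  filter_upwards [hμ] with x hx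
  exact (ofReal_potential_add_swapMap hl hτ hα hβ hM hx.1 hx.2).symm

omit hM in
lemma isOptimalMap_swapMap (hpush : μ.map (swapMap τ a) = μ) :
    IsOptimalMap l μ μ (swapMap τ a) := by
  obtain ⟨M, hM⟩ := exists_abs_potential_le hl hτ a α β
  refine ⟨measurable_swapMap τ a, hpush, fun γ hγ => ?_⟩
  have := lintegral_potential_le hl hτ hα hβ hM hμ hγ
  rw [← planCost_swapMap_add hl hτ hα hβ hM hμ hpush] at this
  exact (ENNReal.add_le_add_iff_right ENNReal.ofReal_ne_top).1 this

-- Complementary slackness: an optimal map closes the duality gap, so the pointwise inequality is an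
-- equality almost everywhere, whereas it is strict off the graph of `swapMap`.
omit hM in
lemma IsOptimalMap.ae_eq_swapMap (hpush : μ.map (swapMap τ a) = μ) {S : ℝ → ℝ}
    (hS : IsOptimalMap l μ μ S) : S =ᵐ[μ] swapMap τ a := by
  obtain ⟨M, hM⟩ := exists_abs_potential_le hl hτ a α β
  have hSμ : ∀ᵐ x ∂μ, S x ∈ Ioo α β ∧ S x ≠ a :=
    ae_of_ae_map hS.measurable.aemeasurable (by rwa [hS.push])
  have hle : ∫⁻ x, cost l x (S x) + ENNReal.ofReal (2 * M) ∂μ ≤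
      ∫⁻ x, ENNReal.ofReal (potential l τ a x + M) +
        ENNReal.ofReal (potential l τ a (S x) + M) ∂μ := by
    rw [← planCost_mapPlan_add hl hS.measurable,
      ← lintegral_potential_add_map hl hτ hS.measurable hS.push,
      ← planCost_swapMap_add hl hτ hα hβ hM hμ hpush]
    gcongr
    exact hS.optimal _ (mapPlan_mem_plans (measurable_swapMap τ a) hpush)
  -- Equality of integrals forces equality almost everywhere only if the smaller function has finite
  -- integral.
  have hfin : ∫⁻ x, ENNReal.ofReal (potential l τ a x + M) +
      ENNReal.ofReal (potential l τ a (S x) + M) ∂μ ≠ ∞ := by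
    refine ne_top_of_le_ne_top (b := ENNReal.ofReal (2 * M) + ENNReal.ofReal (2 * M))
      (ENNReal.add_ne_top.2 ⟨ENNReal.ofReal_ne_top, ENNReal.ofReal_ne_top⟩) ?_
    calc _ ≤ ∫⁻ _, ENNReal.ofReal (2 * M) + ENNReal.ofReal (2 * M) ∂μ := by
          refine lintegral_mono_ae ?_
          filter_upwards [hμ, hSμ] with x hx hSx
          have h1 := abs_le.1 (hM x (Ioo_subset_Icc_self hx.1))
          have h2 := abs_le.1 (hM _ (Ioo_subset_Icc_self hSx.1))
          exact add_le_add (ENNReal.ofReal_le_ofReal (by linarith))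
            (ENNReal.ofReal_le_ofReal (by linarith))
      _ = _ := by simp
  have hmeas : Measurable fun x => cost l x (S x) + ENNReal.ofReal (2 * M) :=
    (hl.measurable_cost.comp (measurable_id.prodMk hS.measurable)).add_const _
  have heq := ae_eq_of_ae_le_of_lintegral_le (μ := μ) ?_ hfin hmeas.aemeasurable hle
  · filter_upwards [hμ, hSμ, heq] with x hx hSx hxe
    by_contra h
    exact (ofReal_potential_add_lt hl hτ hα hM hx.1 hSx.1 hx.2 hSx.2 h).ne hxe
  · filter_upwards [hμ, hSμ] with x hx hSx
    by_cases h : S x = swapMap τ a x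
    · rw [h]
      exact (ofReal_potential_add_swapMap hl hτ hα hβ hM hx.1 hx.2).le
    · exact (ofReal_potential_add_lt hl hτ hα hM hx.1 hSx.1 hx.2 hSx.2 h).le

end duality

/-! ### The distribution function and the half-mass shift. -/

open ProbabilityTheory

lemma continuous_cdf (μ : Measure ℝ) [IsProbabilityMeasure μ] [NullSingletonClass μ] :
    Continuous (cdf μ) := by
  refine continuous_iff_continuousAt.2 fun x => ?_
  rw [(monotone_cdf μ).continuousAt_iff_leftLim_eq_rightLim, StieltjesFunction.rightLim_eq]
  refine le_antisymm ((monotone_cdf μ).leftLim_le le_rfl) ?_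
  have h := StieltjesFunction.measure_singleton (cdf μ) x
  rw [measure_cdf, measure_singleton, eq_comm, ENNReal.ofReal_eq_zero] at h
  linarith

/-- The distribution function of a measure on `[α,β]`, continued with slope one outside `[α,β]`
so as to be a bijection of the line. -/
def extCdf (μ : Measure ℝ) (α β x : ℝ) : ℝ := cdf μ x + (min x α - α) + (max x β - β)

section extCdf

variable {μ : Measure ℝ} [IsProbabilityMeasure μ] [NullSingletonClass μ] {α β : ℝ} (hαβ : α < β)
  (hsupp : μ.support = Icc α β)

include hsupp

omit [IsProbabilityMeasure μ] [NullSingletonClass μ] in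
lemma ae_mem_Icc_of_support : ∀ᵐ x ∂μ, x ∈ Icc α β := hsupp ▸ Measure.support_mem_ae

lemma cdf_eq_zero_of_le {x : ℝ} (hx : x ≤ α) : cdf μ x = 0 := by
  rw [cdf_eq_real, measureReal_def, ← measure_congr Iio_ae_eq_Iic, ENNReal.toReal_eq_zero_iff]
  left
  refine measure_mono_null (fun y hy => ?_) (ae_iff.1 (ae_mem_Icc_of_support hsupp))
  exact fun h => absurd (h.1.trans_lt hy) hx.not_gt

omit [NullSingletonClass μ] in
lemma cdf_eq_one_of_ge {x : ℝ} (hx : β ≤ x) : cdf μ x = 1 := by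
  have : ∀ᵐ y ∂μ, y ∈ Iic x := by
    filter_upwards [ae_mem_Icc_of_support hsupp] with y hy using hy.2.trans hx
  rw [cdf_eq_real, measureReal_def, (prob_compl_eq_zero_iff measurableSet_Iic).1 this,
    ENNReal.toReal_one]

-- The midpoint lies in the support, so the interval around it has positive mass.
omit [NullSingletonClass μ] in
lemma cdf_lt_cdf {x y : ℝ} (hx : α ≤ x) (hxy : x < y) (hy : y ≤ β) : cdf μ x < cdf μ y := by
  have hmid : (x + y) / 2 ∈ μ.support := by
    rw [hsupp]; constructor <;> linarith
  have hpos : 0 < μ (Ioc x y) :=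
    (Measure.mem_support_iff_forall _).1 hmid _
      (Ioc_mem_nhds (by linarith) (by linarith))
  have h := (cdf μ).measure_Ioc x y
  rw [measure_cdf] at h
  rw [h, ENNReal.ofReal_pos] at hpos
  linarith

omit [NullSingletonClass μ] in
lemma strictMono_extCdf : StrictMono (extCdf μ α β) := by
  intro x y hxy
  have h1 := monotone_cdf μ hxy.le
  have h2 : min x α ≤ min y α := min_le_min_right α hxy.le
  have h3 : max x β ≤ max y β := max_le_max_right β hxy.le
  unfold extCdf
  rcases lt_or_ge x α with hx | hx
  · have : min x α < min y α := by rw [min_eq_left hx.le]; exact lt_min hxy hx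
    linarith
  · rcases lt_or_ge β y with hy | hy
    · have : max x β < max y β := by rw [max_eq_left hy.le]; exact max_lt hxy hy
      linarith
    · have := cdf_lt_cdf hsupp hx hxy hy
      linarith

include hαβ

lemma cdf_eq_clamp (x : ℝ) : cdf μ x = max 0 (min 1 (extCdf μ α β x)) := by
  have h0 := cdf_nonneg μ x
  have h1 := cdf_le_one μ x
  unfold extCdf
  rcases le_or_gt x α with hx | hx
  · rw [cdf_eq_zero_of_le hsupp hx, min_eq_left hx, max_eq_right (hx.trans hαβ.le),
      max_eq_left]
    exact (min_le_right _ _).trans (by linarith)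
  · rcases le_or_gt β x with hy | hy
    · rw [cdf_eq_one_of_ge hsupp hy, min_eq_right hx.le, max_eq_left hy, min_eq_left (by linarith),
        max_eq_right zero_le_one]
    · rw [min_eq_right hx.le, max_eq_right hy.le, sub_self, sub_self, add_zero, add_zero,
        min_eq_right h1, max_eq_right h0]

lemma extCdf_left : extCdf μ α β α = 0 := by
  simp [extCdf, cdf_eq_zero_of_le hsupp le_rfl, max_eq_right hαβ.le]

omit [NullSingletonClass μ] in
lemma extCdf_right : extCdf μ α β β = 1 := by
  simp [extCdf, cdf_eq_one_of_ge hsupp le_rfl, min_eq_right hαβ.le]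

omit hsupp hαβ in
lemma surjective_extCdf : Function.Surjective (extCdf μ α β) := by
  refine Continuous.surjective ?_ ?_ ?_
  · exact ((continuous_cdf μ).add ((continuous_id.min continuous_const).sub continuous_const)).add
      ((continuous_id.max continuous_const).sub continuous_const)
  · refine tendsto_atTop_mono' _ ?_ (tendsto_atTop_add_const_right _ (-β) tendsto_id)
    filter_upwards [eventually_ge_atTop α] with x hx
    have := cdf_nonneg μ x
    have := le_max_left x β
    simp only [extCdf, min_eq_right hx, id]
    linarith
  · refine tendsto_atBot_mono' _ ?_ (tendsto_atBot_add_const_right _ (1 - α) tendsto_id)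
    filter_upwards [eventually_le_atBot β] with x hx
    have := cdf_le_one μ x
    have := min_le_left x α
    simp only [extCdf, max_eq_right hx, id]
    linarith

-- The preimage of a half-line consists of one piece on each side of `a`. In the coordinate `e`,
-- where `τ` is translation by 1/2, their masses become explicit clamped functions.
omit hsupp hαβ in
lemma map_swapMap_of_cdf_eq_clamp (e : ℝ ≃o ℝ) (he : ∀ x, cdf μ x = max 0 (min 1 (e x)))
    {τ : ℝ ≃o ℝ} (hτ : ∀ x, e (τ x) = e x + 1 / 2) {a : ℝ} (ha : e a = 1 / 2) :
    μ.map (swapMap τ a) = μ := by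
  have hm := measurable_swapMap τ a
  have hτs (x) : e (τ.symm x) = e x - 1 / 2 := by
    have := hτ (τ.symm x)
    rw [τ.apply_symm_apply] at this
    linarith
  have := Measure.isProbabilityMeasure_map (μ := μ) hm.aemeasurable
  refine Measure.ext_of_Iic _ _ fun t => ?_
  have hpre : swapMap τ a ⁻¹' Iic t = (Iio a ∩ Iic (τ.symm t)) ∪ Icc a (τ t) := by
    ext x
    simp only [swapMap, mem_preimage, mem_Iic, mem_union, mem_inter_iff, mem_Iio, mem_Icc]
    split_ifs with h
    · simp [h, h.not_ge, τ.le_symm_apply]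
    · simp [h, not_lt.1 h, τ.symm_apply_le]
  have hdisj : Disjoint (Iio a ∩ Iic (τ.symm t)) (Icc a (τ t)) :=
    Set.disjoint_left.2 fun x hx hx' => absurd hx'.1 hx.1.not_ge
  have hI : (Iio a ∩ Iic (τ.symm t) : Set ℝ) =ᵐ[μ] Iic (min a (τ.symm t)) := by
    rw [← Iic_inter_Iic]
    exact Iio_ae_eq_Iic.inter (ae_eq_refl _)
  have hIcc : μ (Icc a (τ t)) = ENNReal.ofReal (cdf μ (τ t) - cdf μ a) := by
    rw [← measure_congr Ioc_ae_eq_Icc]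
    conv_lhs => rw [← measure_cdf μ]
    exact (cdf μ).measure_Ioc _ _
  rw [Measure.map_apply hm measurableSet_Iic, hpre, measure_union hdisj measurableSet_Icc,
    measure_congr hI, hIcc, ← ofReal_cdf, ← ofReal_cdf, he, he, he, he, hτ, ha,
    e.monotone.map_min, hτs, ha]
  -- What remains is a real identity in `s`: only the right half contributes for `s ≤ 1/2`; for `s >
  -- 1/2` the right half contributes its full mass 1/2 and the left half the rest.
  generalize e t = s
  rcases le_or_gt s (1 / 2) with hs | hs
  · rw [min_eq_right (by linarith : s - 1 / 2 ≤ 1 / 2), min_eq_right (by linarith : s - 1 / 2 ≤ 1),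
      max_eq_left (by linarith : s - 1 / 2 ≤ 0), ENNReal.ofReal_zero, zero_add,
      min_eq_right (by linarith : s + 1 / 2 ≤ 1), min_eq_right (by linarith : s ≤ 1),
      min_eq_right (by norm_num : (1 / 2 : ℝ) ≤ 1), max_eq_right (by norm_num : (0 : ℝ) ≤ 1 / 2)]
    rcases le_or_gt s 0 with h0 | h0
    · rw [max_eq_left h0, ENNReal.ofReal_zero, ENNReal.ofReal_eq_zero, sub_nonpos]
      exact max_le (by norm_num) (by linarith)
    · rw [max_eq_right h0.le, max_eq_right (by linarith)]
      ring_nf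
  · rw [min_eq_left (by linarith : 1 ≤ s + 1 / 2), max_eq_right (by norm_num : (0 : ℝ) ≤ 1),
      min_eq_right (by norm_num : (1 / 2 : ℝ) ≤ 1), max_eq_right (by norm_num : (0 : ℝ) ≤ 1 / 2),
      ← ENNReal.ofReal_add (le_max_left _ _) (by norm_num)]
    rcases le_or_gt s 1 with h1 | h1
    · rw [min_eq_right (by linarith : s - 1 / 2 ≤ 1 / 2),
        min_eq_right (by linarith : s - 1 / 2 ≤ 1), min_eq_right h1, max_eq_right (by linarith),
        max_eq_right (by linarith)]
      ring_nf
    · rw [min_eq_left (by linarith : 1 / 2 ≤ s - 1 / 2), min_eq_left h1.le]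
      norm_num

/-- The half-mass shift: an increasing bijection `τ` of the line carrying `[α,a]` onto `[a,β]`,
where `a` is the median, such that exchanging the halves along `τ` preserves `μ`. -/
lemma exists_median_shift :
    ∃ (a : ℝ) (τ : ℝ ≃o ℝ), (∀ x, x < τ x) ∧ τ α = a ∧ τ a = β ∧
      μ.map (swapMap τ a) = μ ∧ cdf μ a = 1 / 2 := by
  let e : ℝ ≃o ℝ := (strictMono_extCdf hsupp).orderIsoOfSurjective _ (surjective_extCdf)
  have he (x) : e x = extCdf μ α β x := rfl
  -- Conjugating a translation requires `e` to be a bijection of the whole line, hence the extension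
  -- of the distribution function.
  let τ : ℝ ≃o ℝ := (e.trans (OrderIso.addRight (1 / 2))).trans e.symm
  have hτ (x) : e (τ x) = e x + 1 / 2 := e.apply_symm_apply _
  have hα : e α = 0 := extCdf_left hαβ hsupp
  have hβ : e β = 1 := extCdf_right hαβ hsupp
  have ha : e (e.symm (1 / 2)) = 1 / 2 := e.apply_symm_apply _
  refine ⟨e.symm (1 / 2), τ, fun x => ?_, ?_, ?_, ?_, ?_⟩
  · rw [← e.lt_iff_lt, hτ]
    linarith
  · rw [← e.apply_eq_iff_eq, hτ, hα, ha, zero_add]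
  · rw [← e.apply_eq_iff_eq, hτ, hβ, ha, add_halves]
  · exact map_swapMap_of_cdf_eq_clamp e (cdf_eq_clamp hαβ hsupp) hτ ha
  · rw [cdf_eq_clamp hαβ hsupp, ← he, ha]
    norm_num

end extCdf

/-! ### Order and limit properties of the swap. -/

section swapMap

variable {τ : ℝ ≃o ℝ} {α β a : ℝ}

lemma swapMap_of_lt {x : ℝ} (hx : x < a) : swapMap τ a x = τ x := if_pos hx

lemma swapMap_of_ge {x : ℝ} (hx : a ≤ x) : swapMap τ a x = τ.symm x := if_neg hx.not_gt

lemma image_swapMap_Ioo_left {p q : ℝ} (hq : q ≤ a) :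
    swapMap τ a '' Ioo p q = Ioo (τ p) (τ q) := by
  rw [image_congr fun x hx => swapMap_of_lt (hx.2.trans_le hq), τ.image_Ioo]

lemma image_swapMap_Ioo_right {p q : ℝ} (hp : a ≤ p) :
    swapMap τ a '' Ioo p q = Ioo (τ.symm p) (τ.symm q) := by
  rw [image_congr fun x hx => swapMap_of_ge (hp.trans hx.1.le), τ.symm.image_Ioo]

lemma strictMonoOn_swapMap_Iio : StrictMonoOn (swapMap τ a) (Iio a) := by
  intro x hx y hy h
  rw [swapMap_of_lt hx, swapMap_of_lt hy]
  exact τ.strictMono h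

lemma strictMonoOn_swapMap_Ici : StrictMonoOn (swapMap τ a) (Ici a) := by
  intro x hx y hy h
  rw [swapMap_of_ge hx, swapMap_of_ge hy]
  exact τ.symm.strictMono h

lemma tendsto_swapMap_left (hβ : τ a = β) : Tendsto (swapMap τ a) (𝓝[<] a) (𝓝 β) := by
  rw [← hβ]
  refine ((τ.continuous.tendsto a).mono_left nhdsWithin_le_nhds).congr' ?_
  filter_upwards [self_mem_nhdsWithin] with x hx using (swapMap_of_lt hx).symm

lemma tendsto_swapMap_right (hα : τ α = a) : Tendsto (swapMap τ a) (𝓝[>] a) (𝓝 α) := by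
  have h : τ.symm a = α := by rw [← hα, τ.symm_apply_apply]
  rw [← h]
  refine ((τ.symm.continuous.tendsto a).mono_left nhdsWithin_le_nhds).congr' ?_
  filter_upwards [self_mem_nhdsWithin] with x hx using (swapMap_of_ge (mem_Ioi.1 hx).le).symm

lemma not_continuousWithinAt_swapMap (hα : τ α = a) (hβ : τ a = β) (hαa : α < a) (haβ : a < β) :
    ¬ContinuousWithinAt (swapMap τ a) (Icc α β) a := by
  intro h
  have hlt : Tendsto (swapMap τ a) (𝓝[Ioo α a] a) (𝓝 (swapMap τ a a)) :=
    h.mono fun x hx => ⟨hx.1.le, (hx.2.trans haβ).le⟩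
  rw [nhdsWithin_Ioo_eq_nhdsLT hαa] at hlt
  have := tendsto_nhds_unique hlt (tendsto_swapMap_left hβ)
  rw [swapMap_of_ge le_rfl, ← hα, τ.symm_apply_apply] at this
  linarith

end swapMap

end RepulsiveTransport

end

/-! ### The main theorem. -/

open RepulsiveTransport in
theorem theorem4p1 (l : ℝ≥0∞ → ℝ≥0∞) (hl : RepulsiveTransport.IsRepulsiveCost l)
    (α β : ℝ) (hαβ : α < β)
    (μ : Measure ℝ) [IsProbabilityMeasure μ] (hsupp : μ.support = Icc α β)
    (ρ : ℝ → ℝ≥0) (hρ : AEMeasurable ρ volume)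
    (hμρ : μ = volume.withDensity fun x => (ρ x : ℝ≥0∞))
    (hpos : ∀ x ∈ Icc α β, 0 < ρ x) :
    ∃ (a : ℝ) (T : ℝ → ℝ),
      a ∈ Ioo α β ∧
      -- `T` is (a version of) the optimal map, which is unique up to `μ`-null sets
      RepulsiveTransport.IsOptimalMap l μ μ T ∧
      (∀ S, RepulsiveTransport.IsOptimalMap l μ μ S → S =ᵐ[μ] T) ∧
      -- monotonicity on the two halves, values at the ends, jump at `a`
      StrictMonoOn T (Ico α a) ∧ StrictMonoOn T (Ioc a β) ∧
      T α = a ∧ T β = a ∧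
      Tendsto T (𝓝[<] a) (𝓝 β) ∧ Tendsto T (𝓝[>] a) (𝓝 α) ∧
      ¬ ContinuousWithinAt T (Icc α β) a ∧
      -- the halves are exchanged
      T '' Ioo α a = Ioo a β ∧ T '' Ioo a β = Ioo α a ∧
      -- (a)
      (∀ x ∈ Ioo α a, T x ∈ Ioo a β) ∧
      (∀ x ∈ Ioo α a, ∀ x' ∈ Ioo α a, x < x' → x' < T x ∧ T x < T x') ∧
      -- (b)
      (∀ x ∈ Ioo a β, T x ∈ Ioo α a) ∧
      (∀ x ∈ Ioo a β, ∀ x' ∈ Ioo a β, x < x' → T x < T x' ∧ T x' < x) ∧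
      -- (c) intervals on one side of `a`, and intervals around `a`
      (∀ l₁ l₂ : ℝ, l₁ < l₂ → Ioo l₁ l₂ ⊆ Icc α β → a ∉ Ioo l₁ l₂ →
        ∃ r₁ r₂ : ℝ, r₁ < r₂ ∧ Ioo r₁ r₂ ⊆ Icc α β ∧ T '' Ioo l₁ l₂ = Ioo r₁ r₂) ∧
      (∀ l₁ l₂ : ℝ, Ioo l₁ l₂ ⊆ Icc α β → a ∈ Ioo l₁ l₂ →
        T '' (Ioo l₁ l₂ \ {a}) = Ioo α (T l₂) ∪ Ioo (T l₁) β) ∧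
      -- `a` is the median
      μ (Icc α a) = 1 / 2 ∧ μ (Icc a β) = 1 / 2 := by
  have hac : μ ≪ volume := hμρ ▸ withDensity_absolutelyContinuous _ _
  have : NullSingletonClass μ := ⟨fun x => hac (measure_singleton x)⟩
  obtain ⟨a, τ, hτ, hα, hβ, hpush, hmed⟩ := exists_median_shift hαβ hsupp
  have hαa : α < a := hα ▸ hτ α
  have haβ : a < β := hβ ▸ hτ a
  have hsa : τ.symm a = α := by rw [← hα, τ.symm_apply_apply]
  have hsβ : τ.symm β = a := by rw [← hβ, τ.symm_apply_apply]
  have hne (c : ℝ) : ∀ᵐ x ∂μ, x ≠ c := by simp [ae_iff]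
  have hμ : ∀ᵐ x ∂μ, x ∈ Ioo α β ∧ x ≠ a := by
    filter_upwards [ae_mem_Icc_of_support hsupp, hne α, hne β, hne a] with x hx h1 h2 h3
    exact ⟨⟨lt_of_le_of_ne hx.1 h1.symm, lt_of_le_of_ne hx.2 h2⟩, h3⟩
  have hL := fun x (hx : x ∈ Ioo α a) => swapMap_mem_Ioo_left hα hβ hx
  have hR := fun x (hx : x ∈ Ioo a β) => swapMap_mem_Ioo_right hα hβ hx
  have hmeas (p q : ℝ) :
      μ (Icc p q) = ENNReal.ofReal (ProbabilityTheory.cdf μ q - ProbabilityTheory.cdf μ p) := by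
    rw [← measure_congr Ioc_ae_eq_Icc]
    conv_lhs => rw [← ProbabilityTheory.measure_cdf μ]
    exact (ProbabilityTheory.cdf μ).measure_Ioc _ _
  have hhalf : ENNReal.ofReal (1 / 2) = 1 / 2 := by
    rw [ENNReal.ofReal_div_of_pos two_pos, ENNReal.ofReal_one, ENNReal.ofReal_ofNat]
  -- Taking closures brings the endpoints of the open interval into `[α,β]`.
  have hends {p q : ℝ} (hpq : p < q) (h : Ioo p q ⊆ Icc α β) : α ≤ p ∧ q ≤ β := by
    have := closure_minimal h isClosed_Icc
    rw [closure_Ioo hpq.ne] at this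
    exact ⟨(this (left_mem_Icc.2 hpq.le)).1, (this (right_mem_Icc.2 hpq.le)).2⟩
  refine ⟨a, swapMap τ a, ⟨hαa, haβ⟩, isOptimalMap_swapMap hl hτ hα hβ hμ hpush,
    fun S hS => hS.ae_eq_swapMap hl hτ hα hβ hμ hpush,
    strictMonoOn_swapMap_Iio.mono fun x hx => hx.2,
    strictMonoOn_swapMap_Ici.mono fun x hx => hx.1.le,
    (swapMap_of_lt hαa).trans hα, (swapMap_of_ge haβ.le).trans hsβ,
    tendsto_swapMap_left hβ, tendsto_swapMap_right hα,
    not_continuousWithinAt_swapMap hα hβ hαa haβ,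
    by rw [image_swapMap_Ioo_left le_rfl, hα, hβ],
    by rw [image_swapMap_Ioo_right le_rfl, hsa, hsβ],
    hL,
    fun x hx y hy hxy =>
      ⟨hy.2.trans (hL x hx).1, strictMonoOn_swapMap_Iio hx.2 hy.2 hxy⟩,
    hR,
    fun x hx y hy hxy =>
      ⟨strictMonoOn_swapMap_Ici hx.1.le hy.1.le hxy, (hR y hy).2.trans hx.1⟩,
    fun p q hpq h ha => ?_, fun p q h ha => ?_, ?_, ?_⟩
  · obtain ⟨hp, hq⟩ := hends hpq h
    rcases le_or_gt q a with hqa | hqa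
    · refine ⟨τ p, τ q, τ.strictMono hpq, fun x hx => ⟨?_, ?_⟩, image_swapMap_Ioo_left hqa⟩
      · exact hαa.le.trans ((hα ▸ τ.monotone hp).trans hx.1.le)
      · exact hx.2.le.trans (hβ ▸ τ.monotone hqa)
    · have hap : a ≤ p := not_lt.1 fun hpa => ha ⟨hpa, hqa⟩
      refine ⟨τ.symm p, τ.symm q, τ.symm.strictMono hpq, fun x hx => ⟨?_, ?_⟩,
        image_swapMap_Ioo_right hap⟩
      · exact (hsa ▸ τ.symm.monotone hap).trans hx.1.le
      · exact hx.2.le.trans ((hsβ ▸ τ.symm.monotone hq).trans haβ.le)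
  · have hsplit : Ioo p q \ {a} = Ioo a q ∪ Ioo p a := by
      ext x
      simp only [Set.mem_sdiff, mem_Ioo, mem_singleton_iff, mem_union]
      constructor
      · rintro ⟨hx, hxa⟩
        rcases lt_or_gt_of_ne hxa with h' | h'
        · exact .inr ⟨hx.1, h'⟩
        · exact .inl ⟨h', hx.2⟩
      · rintro (hx | hx)
        · exact ⟨⟨ha.1.trans hx.1, hx.2⟩, hx.1.ne'⟩
        · exact ⟨⟨hx.1, hx.2.trans ha.2⟩, hx.2.ne⟩
    rw [hsplit, image_union, image_swapMap_Ioo_right le_rfl, image_swapMap_Ioo_left le_rfl, hsa,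
      hβ, swapMap_of_lt ha.1, swapMap_of_ge ha.2.le]
  · rw [hmeas, hmed, cdf_eq_zero_of_le hsupp le_rfl, sub_zero, hhalf]
  · rw [hmeas, hmed, cdf_eq_one_of_ge hsupp le_rfl, sub_half, hhalf]
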